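/- Let $(R,\mathfrak m)$ be a Cohen–Macaulay Noetherian local ring of dimension $d$, and let $I=(x_1,\dots,x_d)$ where $x_1,\dots,x_d$ is an $R$-regular sequence (so $I$ is $\mathfrak m$-primary). Put $I^n=R$ for $n\le 0$. An $I$-filtration is a family $\mathcal F=\{I_n\}_{n\in\mathbb Z}$ of ideals with $I_n=R$ for $n\le 0$ such that $I_{n+1}\subseteq I_n$, $I_mI_n\subseteq I_{m+n}$ and $I^n\subseteq I_n$ for all $m,n\in\mathbb Z$; it is $I$-admissible if there is $k\in\mathbb N$ with $I_n\subseteq I^{n-k}$ for all $n$. For $p\in\mathbb Z$, $\mathcal F$ satisfies $HI_p$ if $I_{n+1}\cap I^{n-p}=I_{p+1}I^{n-p}$ for all $n\ge p$. A reduction of $I$ is an ideal $J\subseteq I$ with $JI^n=I^{n+1}$ for all large $n$, and it is minimal if it is minimal under inclusion among the reductions of $I$. Let $r_J(\mathcal F)$ be the least $n\ge 0$ such that $JI_m=I_{m+1}$ for all $m\ge n$, and let $r(\mathcal F)=\min\{r_J(\mathcal F)\mid J\text{ a minimal reduction of }I\}$. Write $\ell$ for length of $R$-modules. The Hilbert coefficients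 $e_0(\mathcal F),\dots,e_d(\mathcal F)$ of $\mathcal F$ are the integers such that, for all large $n$, $$\ell(R/I_n)=\sum_{i=0}^{d}(-1)^i e_i(\mathcal F)\binom{n+d-1-i}{d-i}.$$ **Theorem.** Let $\mathcal F=\{I_n\}$ be an $I$-admissible filtration satisfying $HI_p$ for every integer $p\le r(\mathcal F)-2$. Then the Hilbert coefficients of $\mathcal F$ exist, the lengths $\ell(I_{k+1}/II_k)$, $k\ge 0$, are finite, and for all $i=1,\dots,d$ $$e_i(\mathcal F)=\sum_{k=i-1}^{\infty}\binom{k}{i-1}\,\ell\!\left(\frac{I_{k+1}}{I\,I_k}\right),$$ a sum with only finitely many nonzero terms. -/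

import Mathlib

namespace HilbertCoeff

variable {R : Type*} [CommRing R]

/-- The depth of a Noetherian local ring: the supremum of the lengths of its regular sequences.
(`IsRegular` includes `R / (rs) ≠ 0`, so all entries lie in the maximal ideal.) -/
noncomputable def localDepth (R : Type*) [CommRing R] : ℕ∞ :=
  ⨆ (rs : List R) (_ : RingTheory.Sequence.IsRegular R rs), (rs.length : ℕ∞)

/-- Cohen-Macaulayness of a Noetherian local ring: depth equals Krull dimension. -/
def IsCohenMacaulayLocal (R : Type*) [CommRing R] : Prop :=
  ((localDepth R : ℕ∞) : WithBot ℕ∞) = ringKrullDim R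

/-- The power `I ^ n` for an integer `n`, with `I ^ n = R` for `n ≤ 0`. -/
def intPow (I : Ideal R) (n : ℤ) : Ideal R := I ^ n.toNat

/-- An `I`-filtration: ideals `I_n` (`n ∈ ℤ`), with `I_n = R` for `n ≤ 0`, such that
`I_{n+1} ⊆ I_n`, `I_m I_n ⊆ I_{m+n}` and `I ^ n ⊆ I_n`. -/
structure IFiltration (I : Ideal R) where
  /-- the `n`-th ideal of the filtration -/
  ideal : ℤ → Ideal R
  eq_top : ∀ n : ℤ, n ≤ 0 → ideal n = ⊤
  succ_le : ∀ n : ℤ, ideal (n + 1) ≤ ideal n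
  mul_le : ∀ m n : ℤ, ideal m * ideal n ≤ ideal (m + n)
  pow_le : ∀ n : ℤ, intPow I n ≤ ideal n

/-- The `I`-adic filtration `{I ^ n}`. -/
def adicFiltration (I : Ideal R) : IFiltration I where
  ideal := intPow I
  eq_top n hn := by simp [intPow, Int.toNat_of_nonpos hn]
  succ_le n := Ideal.pow_le_pow_right (by omega)
  mul_le m n := by
    rw [intPow, intPow, ← pow_add]
    exact Ideal.pow_le_pow_right (by omega)
  pow_le _ := le_rfl

namespace IFiltration

variable {I : Ideal R} (F : IFiltration I)

/-- Admissibility: there is `k ∈ ℕ` with `I_n ⊆ I ^ (n - k)` for all `n`. -/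
def IsAdmissible : Prop :=
  ∃ k : ℕ, ∀ n : ℤ, F.ideal n ≤ intPow I (n - k)

/-- The condition `HI_p`: `I_{n+1} ∩ I ^ (n-p) = I_{p+1} I ^ (n-p)` for all `n ≥ p`. -/
def SatisfiesHI (p : ℤ) : Prop :=
  ∀ n : ℤ, p ≤ n →
    F.ideal (n + 1) ⊓ intPow I (n - p) = F.ideal (p + 1) * intPow I (n - p)

/-- `J` is a reduction of `F`: `J ⊆ I_1` and `J I_n = I_{n+1}` for all large `n`. -/
def IsReduction (J : Ideal R) : Prop :=
  J ≤ F.ideal 1 ∧ ∃ N : ℤ, ∀ n : ℤ, N ≤ n → J * F.ideal n = F.ideal (n + 1)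

end IFiltration

/-- `J` is a minimal reduction of the ideal `I`: it is minimal with respect to containment among
the reductions of the `I`-adic filtration. -/
def IsMinimalReduction (I J : Ideal R) : Prop :=
  Minimal (fun K : Ideal R => (adicFiltration I).IsReduction K) J

namespace IFiltration

variable {I : Ideal R} (F : IFiltration I)

/-- The reduction number `r_J(F)`: the smallest `n` such that `J I_m = I_{m+1}` for all `m ≥ n`.
(For a proper ideal `J` no negative `n` qualifies, as then `J I_n = J ≠ R = I_{n+1}`.) -/
noncomputable def reductionNumberWrt (J : Ideal R) : ℕ :=
  sInf {n : ℕ | ∀ m : ℤ, (n : ℤ) ≤ m → J * F.ideal m = F.ideal (m + 1)}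

/-- The reduction number `r(F) = min {r_J(F) | J is a minimal reduction of I}`. -/
noncomputable def reductionNumber : ℕ :=
  sInf {r : ℕ | ∃ J : Ideal R, IsMinimalReduction I J ∧ r = F.reductionNumberWrt J}

/-- The Hilbert function `H_F(n) = ℓ(R / I_n)`. -/
noncomputable def hilbertFunction (n : ℤ) : ℕ∞ :=
  Module.length R (R ⧸ F.ideal n)

/-- `e_0, …, e_d` are the Hilbert coefficients of `F` (with `d = dim R`): for all large `n`, the
length `ℓ(R / I_n)` is finite and equal to `∑_{i=0}^{d} (-1)^i e_i * C(n+d-1-i, d-i)`. -/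
def HasHilbertCoefficients (d : ℕ) (e : Fin (d + 1) → ℤ) : Prop :=
  ∃ N : ℕ, ∀ n : ℕ, N ≤ n → 1 ≤ n →
    F.hilbertFunction n ≠ ⊤ ∧
    ((F.hilbertFunction n).toNat : ℤ) =
      ∑ i : Fin (d + 1), (-1) ^ (i : ℕ) * e i * ((n + d - 1 - i).choose (d - i) : ℤ)

/-- The length `ℓ(I_{k+1} / I I_k)`. -/
noncomputable def stepLength (k : ℕ) : ℕ∞ :=
  Module.length R
    (F.ideal (k + 1) ⧸ (I * F.ideal k).submoduleOf (F.ideal (k + 1)))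

end IFiltration

end HilbertCoeff

/-!
The reduction numbers that enter `r(F)` are those with respect to `I` itself, because an ideal
generated by a system of parameters has no proper reduction (`eq_of_isReduction`). Hence
`I I_m = I_{m+1}` for `m ≥ r(F)`, so that `HI_p` holds trivially for `p ≥ r(F) - 1`, and therefore
for every `p`.

Fix `m` and intersect the powers of `I` with `I_m`. By `HI`, `I_m ∩ I ^ j = I_{m-j} I ^ j`, so the
factors of the chain `I_m ⊇ I_m ∩ I ⊇ ⋯ ⊇ I_m ∩ I ^ m = I ^ m` are, with `k = m - 1 - j`, the images
of `I_{k+1} I ^ j` in `I ^ j / I ^ (j + 1)`. Since `I` is generated by a regular sequence of length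
`d`, the latter is free over `R / I` on the monomials of degree `j`, and the factor has length
`C(j + d - 1, d - 1) ℓ((I_{k+1} + I) / I)` (`subquotientLength_mul_pow`); by `HI` again
`I_{k+1} ∩ I = I I_k`, so `(I_{k+1} + I) / I ≅ I_{k+1} / I I_k`. This gives
`ℓ(R / I_m) = C(m + d - 1, d) ℓ(R / I) - ∑_{k < m} C(m + d - 2 - k, d - 1) ℓ(I_{k+1} / I I_k)`
(`IFiltration.hilbertFunction_add_sum`). Expanding
`C(m + d - 2 - k, d - 1) = ∑_l (-1) ^ l C(k, l) C(m + d - 2 - l, d - 1 - l)`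
(`sum_range_choose_mul_multichoose`) and comparing coefficients, which are unique, yields the
formula.

The freeness of `I ^ j / I ^ (j + 1)` is used only through the length of `R / I ^ n`, which
`isWeaklyRegular_and_length_quotient_pow` computes by induction on the regular sequence. Binomial
coefficients are written as `Nat.multichoose`, with `multichoose m d = C(m + d - 1, d)`.
-/

/-! ### Powers of an ideal generated by a regular sequence -/

namespace HilbertCoeff

open RingTheory.Sequence in
/-- In a short exact sequence `0 → A → B → C → 0`, a sequence that is weakly regular on `A` and on
`C` is weakly regular on `B`, and the sequence stays exact modulo `ys`, so that lengths add up. -/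
theorem isWeaklyRegular_and_length_of_exact.{u} {R : Type*} [CommRing R]
    (ys : List R) : ∀ {A B C : Type u} [AddCommGroup A] [Module R A] [AddCommGroup B] [Module R B]
      [AddCommGroup C] [Module R C] (f : A →ₗ[R] B) (g : B →ₗ[R] C),
      Function.Injective f → Function.Surjective g → Function.Exact f g →
      IsWeaklyRegular A ys → IsWeaklyRegular C ys →
      IsWeaklyRegular B ys ∧
        Module.length R (B ⧸ (Ideal.ofList ys • ⊤ : Submodule R B)) =
          Module.length R (A ⧸ (Ideal.ofList ys • ⊤ : Submodule R A)) +
            Module.length R (C ⧸ (Ideal.ofList ys • ⊤ : Submodule R C)) := by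
  induction ys with
  | nil =>
    intro A B C _ _ _ _ _ _ f g hf hg hfg _ _
    refine ⟨.nil R B, ?_⟩
    have e (M : Type u) [AddCommGroup M] [Module R M] :
        Module.length R (M ⧸ (Ideal.ofList ([] : List R) • ⊤ : Submodule R M)) =
          Module.length R M := by
      rw [Ideal.ofList_nil, Submodule.bot_smul]
      exact (Submodule.quotEquivOfEqBot ⊥ rfl).length_eq
    rw [e, e, e, Module.length_eq_add_of_exact f g hf hg hfg]
  | cons y ys ih =>
    intro A B C _ _ _ _ _ _ f g hf hg hfg hA hC
    rw [isWeaklyRegular_cons_iff] at hA hC ⊢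
    -- regularity of `y` on `C` keeps `f` injective modulo `y`: apply the four-term exactness lemma
    -- to `0 → A → B → C`
    have hz : Function.Exact (0 : Unit →ₗ[R] A) f := by
      intro a
      simpa [eq_comm] using (map_eq_zero_iff f hf)
    have hf' : Function.Injective (QuotSMulTop.map y f) := by
      have h := QuotSMulTop.map_first_exact_on_four_term_exact_of_isSMulRegular_last hz hfg hC.1
      rw [injective_iff_map_eq_zero]
      intro a ha
      obtain ⟨b, rfl⟩ := (h a).mp ha
      simp
    obtain ⟨h1, h2⟩ := ih (QuotSMulTop.map y f) (QuotSMulTop.map y g) hf'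
      (QuotSMulTop.map_surjective y hg) (QuotSMulTop.map_exact y hfg hg) hA.2 hC.2
    refine ⟨⟨isSMulRegular_of_range_eq_ker hf hfg.linearMap_ker_eq.symm hA.1 hC.1, h1⟩, ?_⟩
    simpa only [(Submodule.quotOfListConsSMulTopEquivQuotSMulTopInner _ y ys).length_eq] using h2

theorem length_quotient_quotient_smul_top {R : Type*} [CommRing R] (J L : Ideal R) :
    Module.length R ((R ⧸ J) ⧸ (L • ⊤ : Submodule R (R ⧸ J))) = Module.length R (R ⧸ (J ⊔ L)) := by
  refine LinearEquiv.length_eq (Submodule.quotEquivOfEq _ _ ?_ ≪≫ₗ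
    Submodule.quotientQuotientEquivQuotientSup J L)
  have : L = L • (⊤ : Submodule R R) := by simp
  conv_rhs => rw [this, Submodule.map_smul'', Submodule.map_top, Submodule.range_mkQ]

theorem sup_pow_succ {R : Type*} [CommRing R] (K A : Ideal R) (n : ℕ) :
    (K ⊔ A) ^ (n + 1) = K ^ (n + 1) ⊔ A * (K ⊔ A) ^ n := by
  induction n with
  | zero => simp
  | succ n ih =>
    apply le_antisymm
    · rw [pow_succ' (K ⊔ A) (n + 1), Ideal.sup_mul]
      refine sup_le ?_ le_sup_right
      rw [ih, Ideal.mul_sup, ← pow_succ']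
      refine sup_le_sup_left ?_ _
      rw [mul_left_comm, ← ih, pow_succ' (K ⊔ A) n]
      exact Ideal.mul_mono_right (Ideal.mul_mono_left le_sup_left)
    · refine sup_le (Ideal.pow_right_mono le_sup_left _) ?_
      rw [pow_succ' (K ⊔ A) (n + 1)]
      exact Ideal.mul_mono_left le_sup_right

open RingTheory.Sequence in
/-- If `xs ++ ys` is weakly regular and `K = (xs)`, then `ys` is weakly regular on every power
quotient `R / K ^ (n + 1)`, and the length of `R / (K ^ (n + 1), ys)` is that of `R / (K, ys)` times
the number of monomials of degree at most `n` in `xs`. Keeping track of `ys` is what makes the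
induction on `xs` work: appending `a` to `xs` uses the case of `a :: ys`, through the exact sequence
`0 → R / I ^ n → R / I ^ (n + 1) → R / (K ^ (n + 1), a) → 0` whose first map is multiplication by
`a`, where `I = (K, a)`. -/
theorem isWeaklyRegular_and_length_quotient_pow {R : Type*} [CommRing R] (xs : List R) :
    ∀ ys : List R, IsWeaklyRegular R (xs ++ ys) → ∀ n : ℕ,
      IsWeaklyRegular (R ⧸ Ideal.ofList xs ^ (n + 1)) ys ∧
      Module.length R (R ⧸ (Ideal.ofList xs ^ (n + 1) ⊔ Ideal.ofList ys)) =
        (xs.length + 1).multichoose n *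
          Module.length R (R ⧸ (Ideal.ofList xs ⊔ Ideal.ofList ys)) := by
  induction xs using List.reverseRecOn with
  | nil =>
    intro ys hys n
    refine ⟨?_, by rw [Ideal.ofList_nil, ← Ideal.zero_eq_bot, zero_pow n.succ_ne_zero]; simp⟩
    exact ((Submodule.quotEquivOfEqBot (M := R) _ (by simp)).isWeaklyRegular_congr ys).mpr hys
  | append_singleton xs a ih =>
    intro ys hys n
    set K := Ideal.ofList xs with hK
    have hI : Ideal.ofList (xs ++ [a]) = K ⊔ Ideal.span {a} := by simp [hK]
    rw [hI]
    set I := K ⊔ Ideal.span {a} with hIdef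
    induction n with
    | zero =>
      refine ⟨?_, by rw [zero_add, pow_one]; simp⟩
      refine ((Submodule.quotEquivOfEq _ _ ?_).isWeaklyRegular_congr ys).mp
        ((isWeaklyRegular_append_iff R _ _).mp hys).2
      simp [hI]
    | succ n ihn =>
      obtain ⟨h1, h2⟩ := ih (a :: ys) (by simpa using hys) (n + 1)
      rw [isWeaklyRegular_cons_iff] at h1
      have hpow : I ^ (n + 1 + 1) = K ^ (n + 1 + 1) ⊔ Ideal.span {a} * I ^ (n + 1) :=
        sup_pow_succ _ _ _
      have hKI : K ^ (n + 1 + 1) ≤ I ^ (n + 1 + 1) := hpow ▸ le_sup_left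
      have hC : IsWeaklyRegular (R ⧸ (K ^ (n + 1 + 1) ⊔ Ideal.span {a})) ys := by
        refine (LinearEquiv.isWeaklyRegular_congr ?_ ys).mp h1.2
        refine Submodule.quotEquivOfEq _ _ ?_ ≪≫ₗ
          Submodule.quotientQuotientEquivQuotientSup (K ^ (n + 1 + 1)) (Ideal.span {a})
        have : Ideal.span {a} = Ideal.span {a} • (⊤ : Submodule R R) := by simp
        rw [this, Submodule.map_smul'', Submodule.map_top, Submodule.range_mkQ,
          Submodule.ideal_span_singleton_smul]
      let f : (R ⧸ I ^ (n + 1)) →ₗ[R] (R ⧸ I ^ (n + 1 + 1)) :=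
        Submodule.mapQ _ _ (LinearMap.lsmul R R a) (by
          intro r hr
          rw [Submodule.mem_comap, hpow]
          exact Ideal.mem_sup_right (Ideal.mul_mem_mul (Ideal.mem_span_singleton_self a) hr))
      have hle : I ^ (n + 1 + 1) ≤ K ^ (n + 1 + 1) ⊔ Ideal.span {a} := by
        rw [hpow]; exact sup_le_sup_left Ideal.mul_le_left _
      let g : (R ⧸ I ^ (n + 1 + 1)) →ₗ[R] (R ⧸ (K ^ (n + 1 + 1) ⊔ Ideal.span {a})) :=
        Submodule.factor hle
      -- `I ^ (n + 2) : a = I ^ (n + 1)`, as `a` is regular modulo `K ^ (n + 2)`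
      have hf : Function.Injective f := by
        rw [injective_iff_map_eq_zero]
        intro r hr
        obtain ⟨r, rfl⟩ := Submodule.Quotient.mk_surjective _ r
        have hr' : a * r ∈ I ^ (n + 1 + 1) := (Submodule.Quotient.mk_eq_zero _).mp hr
        rw [hpow, Submodule.mem_sup] at hr'
        obtain ⟨k, hk, b, hb, hkb⟩ := hr'
        obtain ⟨b, hb', rfl⟩ := Ideal.mem_span_singleton_mul.mp hb
        have h3 : r - b ∈ K ^ (n + 1 + 1) :=
          mem_of_isSMulRegular_quotient_of_smul_mem h1.1 (by
            have : a • (r - b) = k := by rw [smul_eq_mul, mul_sub, ← hkb]; ring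
            rwa [this])
        refine (Submodule.Quotient.mk_eq_zero _).mpr ?_
        have h4 := Ideal.add_mem _ (Ideal.pow_le_pow_right (Nat.le_succ _) (hKI h3)) hb'
        simpa using h4
      have hg : Function.Surjective g := Submodule.factor_surjective hle
      have hfg : Function.Exact f g := by
        intro r
        obtain ⟨r, rfl⟩ := Submodule.Quotient.mk_surjective _ r
        constructor
        · intro hr
          have hr' : r ∈ K ^ (n + 1 + 1) ⊔ Ideal.span {a} :=
            (Submodule.Quotient.mk_eq_zero _).mp hr
          obtain ⟨k, hk, b, hb, hkb⟩ := Submodule.mem_sup.mp hr'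
          obtain ⟨b, rfl⟩ := Ideal.mem_span_singleton.mp hb
          refine ⟨Submodule.Quotient.mk b, (Submodule.Quotient.eq _).mpr ?_⟩
          have : a • b - r = -k := by rw [← hkb, smul_eq_mul]; ring
          change a • b - r ∈ _
          rw [this]
          exact neg_mem (hKI hk)
        · rintro ⟨b, hb⟩
          obtain ⟨b, rfl⟩ := Submodule.Quotient.mk_surjective _ b
          rw [← hb]
          refine (Submodule.Quotient.mk_eq_zero _).mpr ?_
          exact Ideal.mem_sup_right (Ideal.mul_mem_right _ _ (Ideal.mem_span_singleton_self a))
      obtain ⟨h5, h6⟩ := isWeaklyRegular_and_length_of_exact ys f g hf hg hfg ihn.1 hC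
      refine ⟨h5, ?_⟩
      simp only [length_quotient_quotient_smul_top] at h6
      rw [h6, ihn.2]
      rw [Ideal.ofList_cons, ← sup_assoc, ← sup_assoc, ← hIdef] at h2
      rw [h2, List.length_append, List.length_singleton,
        Nat.multichoose_succ_succ (xs.length + 1) n, Nat.cast_add, add_mul, add_comm]

/-! ### Lengths of subquotients -/

/-- The length of the subquotient `A / (A ∩ B)`. -/
noncomputable def subquotientLength {R : Type*} [CommRing R] (A B : Ideal R) : ℕ∞ :=
  Module.length R (A ⧸ B.submoduleOf A)

section

variable {R : Type*} [CommRing R]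

theorem length_quotient_eq_add {A B : Ideal R} (h : B ≤ A) :
    Module.length R (R ⧸ B) = subquotientLength A B + Module.length R (R ⧸ A) := by
  refine Module.length_eq_add_of_exact (Submodule.mapQ (B.submoduleOf A) B A.subtype le_rfl)
    (Submodule.factor h) ?_ (Submodule.factor_surjective h) ?_
  · rw [injective_iff_map_eq_zero]
    intro a ha
    obtain ⟨a, rfl⟩ := Submodule.Quotient.mk_surjective _ a
    exact (Submodule.Quotient.mk_eq_zero _).mpr ((Submodule.Quotient.mk_eq_zero B).mp ha)
  · intro r
    obtain ⟨r, rfl⟩ := Submodule.Quotient.mk_surjective _ r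
    constructor
    · intro hr
      exact ⟨Submodule.Quotient.mk ⟨r, (Submodule.Quotient.mk_eq_zero A).mp hr⟩, rfl⟩
    · rintro ⟨a, ha⟩
      obtain ⟨a, rfl⟩ := Submodule.Quotient.mk_surjective _ a
      rw [← ha]
      exact (Submodule.Quotient.mk_eq_zero A).mpr a.2

/-- The second isomorphism theorem, on lengths. -/
theorem subquotientLength_inf_left (A C : Ideal R) :
    subquotientLength A (A ⊓ C) = subquotientLength (A ⊔ C) C :=
  (LinearMap.quotientInfEquivSupQuotient A C).length_eq

theorem subquotientLength_ne_top {A B : Ideal R} (h : B ≤ A)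
    (hB : Module.length R (R ⧸ B) ≠ ⊤) : subquotientLength A B ≠ ⊤ := by
  rw [length_quotient_eq_add h] at hB
  exact fun h' => hB (by simp [h'])

/-- Multiplying by the generators `s i` maps `⨁ i, A / B` onto `A L / B L`, where `L = (s)`. -/
theorem subquotientLength_mul_le {ι : Type*} [Fintype ι] (s : ι → R) {A B : Ideal R} :
    subquotientLength (A * Ideal.span (Set.range s)) (B * Ideal.span (Set.range s)) ≤
      Fintype.card ι * subquotientLength A B := by
  classical
  set L := Ideal.span (Set.range s)
  have hs (i : ι) : s i ∈ L := Ideal.subset_span ⟨i, rfl⟩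
  let m (i : ι) : A →ₗ[R] (A * L : Ideal R) :=
    ((LinearMap.lsmul R R (s i)).comp A.subtype).codRestrict (A * L) fun a => by
      simpa [mul_comm] using Ideal.mul_mem_mul a.2 (hs i)
  let q (i : ι) : (A ⧸ B.submoduleOf A) →ₗ[R] ((A * L : Ideal R) ⧸ (B * L).submoduleOf (A * L)) :=
    Submodule.mapQ _ _ (m i) fun a ha => by
      change s i * (a : R) ∈ B * L
      rw [mul_comm (s i)]
      exact Ideal.mul_mem_mul (Submodule.mem_comap.mp ha) (hs i)
  let Φ : (ι → A ⧸ B.submoduleOf A) →ₗ[R] ((A * L : Ideal R) ⧸ (B * L).submoduleOf (A * L)) :=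
    ∑ i, (q i).comp (LinearMap.proj i)
  have hΦ : Function.Surjective Φ := by
    have key : ∀ z : R, z ∈ A * L → ∃ a : ι → A, ∑ i, s i * (a i : R) = z := by
      intro z hz
      induction hz using Submodule.mul_induction_on' with
      | mem_mul_mem a ha l hl =>
        obtain ⟨c, hc⟩ := (Submodule.mem_span_range_iff_exists_fun R).mp hl
        refine ⟨fun i => ⟨c i * a, A.mul_mem_left _ ha⟩, ?_⟩
        rw [← hc, Finset.mul_sum]
        refine Finset.sum_congr rfl fun i _ => ?_
        rw [smul_eq_mul]; ring
      | add z _ w _ hz hw =>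
        obtain ⟨a, ha⟩ := hz
        obtain ⟨b, hb⟩ := hw
        exact ⟨a + b, by simp [mul_add, Finset.sum_add_distrib, ha, hb]⟩
    intro z
    obtain ⟨⟨z, hz⟩, rfl⟩ := Submodule.Quotient.mk_surjective _ z
    obtain ⟨a, ha⟩ := key z hz
    refine ⟨fun i => Submodule.Quotient.mk (a i), ?_⟩
    have h1 : Φ (fun i => Submodule.Quotient.mk (a i)) =
        Submodule.Quotient.mk (∑ i, m i (a i)) := by
      rw [← Submodule.mkQ_apply, map_sum]
      simp [Φ, q, LinearMap.sum_apply]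
    rw [h1]
    congr 1
    apply Subtype.ext
    refine Eq.trans ?_ ha
    simp [m]
  refine (Module.length_le_of_surjective Φ hΦ).trans ?_
  rw [Module.length_pi, ENat.card_eq_coe_fintype_card]
  rfl

/-- The `j`-th power of `(x)` is generated by the monomials of degree `j` in `x`. -/
theorem exists_sym_span_eq_ofList_pow (x : List R) (j : ℕ) :
    ∃ s : Sym (Fin x.length) j → R, Ideal.ofList x ^ j = Ideal.span (Set.range s) := by
  refine ⟨fun t => ((t : Multiset (Fin x.length)).map x.get).prod, ?_⟩
  have hx : Ideal.ofList x = Ideal.span (Set.range x.get) := by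
    rw [Set.range_list_get]
  rw [hx, Ideal.span, Submodule.span_pow]
  congr 1
  ext z
  rw [Set.mem_pow]
  constructor
  · rintro ⟨f, rfl⟩
    choose g hg using fun i => (f i).2
    refine ⟨⟨(List.ofFn g : Multiset (Fin x.length)), by simp⟩, ?_⟩
    simp [List.map_ofFn, Function.comp_def, ← hg]
  · rintro ⟨t, rfl⟩
    obtain ⟨⟨t⟩, ht⟩ := t
    have ht' : t.length = j := ht
    subst ht'
    refine ⟨fun i => ⟨x.get (t.get i), ⟨_, rfl⟩⟩, ?_⟩
    have : List.ofFn (fun i => x.get (t.get i)) = t.map x.get := by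
      rw [← Function.comp_def x.get, ← List.map_ofFn, List.ofFn_get]
    simpa using congrArg List.prod this

open RingTheory.Sequence in
/-- For `I` generated by a regular sequence of length `d`, the module `I ^ j / I ^ (j + 1)` is free
over `R / I` on the monomials of degree `j`, so that `A I ^ j / I ^ (j + 1)` is a sum of copies of
`A / I`, one for each such monomial. On lengths it is enough to bound `A I ^ j / I ^ (j + 1)` and
`I ^ j / A I ^ j` from above, since the sum of the two bounds is the known length of
`I ^ j / I ^ (j + 1)`. -/
theorem subquotientLength_mul_pow {x : List R} (hx : IsWeaklyRegular R x)
    (hfin : Module.length R (R ⧸ Ideal.ofList x) ≠ ⊤) {A : Ideal R} (hA : Ideal.ofList x ≤ A)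
    (j : ℕ) :
    subquotientLength (A * Ideal.ofList x ^ j) (Ideal.ofList x ^ (j + 1)) =
      x.length.multichoose j * subquotientLength A (Ideal.ofList x) := by
  set I := Ideal.ofList x with hI
  have hpow (n : ℕ) : Module.length R (R ⧸ I ^ (n + 1)) =
      (x.length + 1).multichoose n * Module.length R (R ⧸ I) := by
    have h := (isWeaklyRegular_and_length_quotient_pow x [] (by simpa using hx) n).2
    rwa [Ideal.ofList_nil, sup_bot_eq, sup_bot_eq] at h
  cases j with
  | zero => simp
  | succ j =>
    obtain ⟨s, hs⟩ := exists_sym_span_eq_ofList_pow x (j + 1)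
    rw [← hI] at hs
    have h1 : subquotientLength (A * I ^ (j + 1)) (I ^ (j + 1 + 1)) ≤
        x.length.multichoose (j + 1) * subquotientLength A I := by
      rw [pow_succ' I (j + 1), hs]
      simpa [Sym.card_sym_eq_multichoose] using subquotientLength_mul_le s (A := A) (B := I)
    have h2 : subquotientLength (I ^ (j + 1)) (A * I ^ (j + 1)) ≤
        x.length.multichoose (j + 1) * Module.length R (R ⧸ A) := by
      have h := subquotientLength_mul_le s (A := ⊤) (B := A)
      have e : Module.length R (R ⧸ A) = subquotientLength ⊤ A := by
        have : Subsingleton (R ⧸ (⊤ : Ideal R)) := Ideal.Quotient.subsingleton_iff.mpr rfl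
        rw [length_quotient_eq_add (le_top : A ≤ ⊤), Module.length_eq_zero, add_zero]
      rw [e]
      simpa [← hs, Sym.card_sym_eq_multichoose, Ideal.top_mul] using h
    have hle1 : I ^ (j + 1 + 1) ≤ A * I ^ (j + 1) := by
      rw [pow_succ' I (j + 1)]; exact Ideal.mul_mono_left hA
    have h3 := length_quotient_eq_add hle1
    have h4 := length_quotient_eq_add (Ideal.mul_le_right : A * I ^ (j + 1) ≤ I ^ (j + 1))
    have h5 := length_quotient_eq_add hA
    rw [h4, hpow, hpow, Nat.multichoose_succ_succ] at h3
    have f1 := hfin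
    rw [h5] at f1
    generalize Module.length R (R ⧸ I) = l at *
    generalize Module.length R (R ⧸ A) = p at *
    generalize subquotientLength A I = q at *
    generalize subquotientLength (A * I ^ (j + 1)) (I ^ (j + 1 + 1)) = u at *
    generalize subquotientLength (I ^ (j + 1)) (A * I ^ (j + 1)) = w at *
    generalize x.length.multichoose (j + 1) = N at *
    generalize (x.length + 1).multichoose j = N' at *
    lift l to ℕ using hfin
    lift q to ℕ using fun h => f1 (by simp [h])
    lift p to ℕ using fun h => f1 (by simp [h])
    lift u to ℕ using ne_top_of_le_ne_top (by exact_mod_cast ENat.natCast_ne_top (N * q)) h1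
    lift w to ℕ using ne_top_of_le_ne_top (by exact_mod_cast ENat.natCast_ne_top (N * p)) h2
    norm_cast at *
    subst h5
    nlinarith
end

/-! ### Reductions -/

/-- By Artin-Rees theory: shifted by the constant of admissibility, `F` is contained in the `I`-adic
filtration, and so it is stable. -/
theorem IFiltration.eventually_mul_eq {R : Type*} [CommRing R] [IsNoetherianRing R] {I : Ideal R}
    (F : IFiltration I) (hF : F.IsAdmissible) :
    ∃ N : ℕ, ∀ m : ℤ, (N : ℤ) ≤ m → I * F.ideal m = F.ideal (m + 1) := by
  obtain ⟨k, hk⟩ := hF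
  have hI : I ≤ F.ideal 1 := by simpa [intPow] using F.pow_le 1
  let G : I.Filtration R :=
    { N := fun n => F.ideal (n + k)
      mono := fun n => by
        have h := F.succ_le (n + k)
        rwa [add_right_comm] at h
      smul_le := fun n => by
        have h := (Ideal.mul_mono_left hI).trans (F.mul_le 1 (n + k))
        rwa [add_comm (1 : ℤ), add_right_comm] at h }
  have hG : G.Stable := by
    refine (I.stableFiltration_stable ⊤).of_le ?_
    intro n
    change F.ideal (n + k) ≤ I ^ n • ⊤
    simpa [intPow] using hk (n + k)
  obtain ⟨n₀, hn₀⟩ := hG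
  refine ⟨n₀ + k, fun m hm => ?_⟩
  have h := hn₀ (m - k).toNat (by omega)
  change I * F.ideal ((m - k).toNat + k) = F.ideal (((m - k).toNat + 1 : ℕ) + k) at h
  have e1 : (((m - k).toNat : ℕ) : ℤ) + k = m := by omega
  have e2 : (((m - k).toNat + 1 : ℕ) : ℤ) + k = m + 1 := by omega
  rwa [e1, e2] at h

theorem isReduction_adicFiltration_self {R : Type*} [CommRing R] (I : Ideal R) :
    (adicFiltration I).IsReduction I := by
  refine ⟨by simp [adicFiltration, intPow], 0, fun n hn => ?_⟩
  change I * I ^ n.toNat = I ^ (n + 1).toNat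
  rw [← pow_succ', Int.toNat_add hn zero_le_one]
  rfl

/-- If `I` is generated by `d` elements and `J + 𝔪 I` is strictly smaller than `I`, then `J` is
generated modulo `𝔪 I` by fewer than `d` elements of `I`: lift a basis of the image of `J` in
`I / 𝔪 I`. The argument works with coefficient vectors over the residue field. -/
theorem exists_fin_le_span_sup {R : Type*} [CommRing R] [IsLocalRing R]
    {I J : Ideal R} {d : ℕ} (s : Fin d → R) (hs : Ideal.span (Set.range s) = I) (hJ : J ≤ I)
    (hne : J ⊔ IsLocalRing.maximalIdeal R * I ≠ I) :
    ∃ t < d, ∃ y : Fin t → R, Ideal.span (Set.range y) ≤ I ∧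
      J ≤ Ideal.span (Set.range y) ⊔ IsLocalRing.maximalIdeal R * I := by
  set k := IsLocalRing.ResidueField R
  have hmem (u : Fin d → R) : ∑ i, u i * s i ∈ I := by
    rw [← hs]
    exact Ideal.sum_mem _ fun i _ => Ideal.mul_mem_left _ _ (Ideal.subset_span ⟨i, rfl⟩)
  have hcombo {z : R} (hz : z ∈ I) : ∃ u : Fin d → R, ∑ i, u i * s i = z :=
    (Submodule.mem_span_range_iff_exists_fun R).mp (by rw [← hs] at hz; exact hz)
  have hres {u v : Fin d → R} (h : ∀ i, IsLocalRing.residue R (u i) = IsLocalRing.residue R (v i)) :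
      ∑ i, u i * s i - ∑ i, v i * s i ∈ IsLocalRing.maximalIdeal R * I := by
    rw [← Finset.sum_sub_distrib]
    refine Ideal.sum_mem _ fun i _ => ?_
    rw [← sub_mul]
    refine Ideal.mul_mem_mul ?_ (hs ▸ Ideal.subset_span ⟨i, rfl⟩)
    rw [← IsLocalRing.residue_eq_zero_iff, map_sub, h i, sub_self]
  -- the coefficient vectors, modulo the maximal ideal, of the elements of `J + 𝔪 I`
  let W : Submodule k (Fin d → k) :=
    { carrier := {w | ∃ u : Fin d → R, ∑ i, u i * s i ∈ J ⊔ IsLocalRing.maximalIdeal R * I ∧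
        ∀ i, IsLocalRing.residue R (u i) = w i}
      zero_mem' := ⟨0, by simp, by simp⟩
      add_mem' := by
        rintro v w ⟨u, hu, huv⟩ ⟨u', hu', huw⟩
        exact ⟨u + u', by simpa [add_mul, Finset.sum_add_distrib] using add_mem hu hu',
          by simp [huv, huw]⟩
      smul_mem' := by
        rintro c w ⟨u, hu, huw⟩
        obtain ⟨c, rfl⟩ := IsLocalRing.residue_surjective c
        refine ⟨c • u, ?_, by simp [huw]⟩
        simpa [Finset.mul_sum, mul_assoc] using Ideal.mul_mem_left _ c hu }
  have hW : W ≠ ⊤ := by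
    intro hW
    refine hne (le_antisymm (sup_le hJ Ideal.mul_le_right) fun z hz => ?_)
    obtain ⟨v, rfl⟩ := hcombo hz
    obtain ⟨u, hu, huv⟩ : (fun i => IsLocalRing.residue R (v i)) ∈ W := hW ▸ Submodule.mem_top
    rw [← sub_add_cancel (∑ i, v i * s i) (∑ i, u i * s i)]
    exact add_mem (Ideal.mem_sup_right (hres fun i => (huv i).symm)) hu
  have hlt : Module.finrank k W < d := by simpa using Submodule.finrank_lt hW
  let b := Module.finBasis k W
  choose u hu hub using fun j => (b j).2
  refine ⟨Module.finrank k W, hlt, fun j => ∑ i, u j i * s i, ?_, fun z hz => ?_⟩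
  · rw [Ideal.span_le]
    rintro _ ⟨j, rfl⟩
    exact hmem _
  · obtain ⟨v, hv⟩ := hcombo (hJ hz)
    let w : W := ⟨fun i => IsLocalRing.residue R (v i), v, hv ▸ Ideal.mem_sup_left hz, fun _ => rfl⟩
    choose c hc using fun j => IsLocalRing.residue_surjective (b.repr w j)
    have hw : ∀ i, IsLocalRing.residue R (v i) =
        IsLocalRing.residue R ((∑ j, c j • u j) i) := by
      intro i
      have h := congrArg (fun x : W => (x : Fin d → k) i) (b.sum_repr w)
      simp only [Submodule.coe_sum, Finset.sum_apply, Submodule.coe_smul, Pi.smul_apply,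
        smul_eq_mul] at h
      simp only [Finset.sum_apply, Pi.smul_apply, smul_eq_mul, map_sum, map_mul, hc, hub]
      exact h.symm
    rw [← hv, ← sub_add_cancel (∑ i, v i * s i) (∑ i, (∑ j, c j • u j) i * s i)]
    refine add_mem (Ideal.mem_sup_right (hres hw)) (Ideal.mem_sup_left ?_)
    have e : ∑ i, (∑ j, c j • u j) i * s i = ∑ j, c j * ∑ i, u j i * s i := by
      simp only [Finset.sum_apply, Pi.smul_apply, smul_eq_mul, Finset.sum_mul, Finset.mul_sum]
      rw [Finset.sum_comm]
      simp only [mul_assoc]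
    rw [e]
    exact Ideal.sum_mem _ fun j _ => Ideal.mul_mem_left _ _ (Ideal.subset_span ⟨j, rfl⟩)

/-- An `𝔪`-primary ideal generated by `d = dim R` elements has no reduction but itself: a smaller
reduction would, by Nakayama's lemma, yield fewer than `d` elements generating an `𝔪`-primary ideal,
against Krull's height theorem. -/
theorem eq_of_isReduction {R : Type*} [CommRing R] [IsLocalRing R] [IsNoetherianRing R]
    {d : ℕ} (hdim : ringKrullDim R = d) {I J : Ideal R} (s : Fin d → R)
    (hs : Ideal.span (Set.range s) = I)
    (hprim : ∀ P : Ideal R, P.IsPrime → I ≤ P → P = IsLocalRing.maximalIdeal R)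
    (hI : I ≤ IsLocalRing.maximalIdeal R)
    (hJ : (adicFiltration I).IsReduction J) : J = I := by
  obtain ⟨hJI, N, hN⟩ := hJ
  replace hJI : J ≤ I := by simpa [adicFiltration, intPow] using hJI
  replace hN : J * I ^ N.toNat = I ^ (N.toNat + 1) := by
    have h := hN N.toNat (Int.self_le_toNat N)
    change J * I ^ ((N.toNat : ℤ)).toNat = I ^ ((N.toNat : ℤ) + 1).toNat at h
    rwa [Int.toNat_add (by omega) zero_le_one, Int.toNat_natCast] at h
  set n := N.toNat
  refine le_antisymm hJI ?_
  by_cases hne : J ⊔ IsLocalRing.maximalIdeal R * I = I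
  · exact Submodule.le_of_le_smul_of_le_jacobson_bot (IsNoetherian.noetherian I)
      (IsLocalRing.maximalIdeal_le_jacobson ⊥) hne.ge
  exfalso
  obtain ⟨t, ht, y, hyI, hy⟩ := exists_fin_le_span_sup s hs hJI hne
  set Y := Ideal.span (Set.range y)
  have h1 : I ^ (n + 1) ≤ Y := by
    refine Submodule.le_of_le_smul_of_le_jacobson_bot (IsNoetherian.noetherian _)
      (IsLocalRing.maximalIdeal_le_jacobson ⊥) ?_
    calc I ^ (n + 1) = J * I ^ n := hN.symm
      _ ≤ (Y ⊔ IsLocalRing.maximalIdeal R * I) * I ^ n := Ideal.mul_mono_left hy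
      _ = Y * I ^ n ⊔ IsLocalRing.maximalIdeal R * I ^ (n + 1) := by
        rw [Ideal.sup_mul, mul_assoc, ← pow_succ']
      _ ≤ _ := sup_le_sup_right Ideal.mul_le_left _
  have hPy (P : Ideal R) (hP : P.IsPrime) (h : Y ≤ P) : P = IsLocalRing.maximalIdeal R :=
    hprim P hP (hP.le_of_pow_le (h1.trans h))
  have h2 : (d : ℕ∞) ≤ t := by
    have hh : (IsLocalRing.maximalIdeal R).height = d := by
      have := IsLocalRing.maximalIdeal_height_eq_ringKrullDim (R := R)
      rw [hdim] at this
      exact_mod_cast this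
    rw [← hh]
    have hY : Y ≠ ⊤ := fun h =>
      Ideal.IsPrime.ne_top' (top_le_iff.mp (h ▸ hyI.trans hI))
    have hYh : (IsLocalRing.maximalIdeal R).height ≤ Y.height := by
      rw [Ideal.height_eq_inf_minimalPrimes Y]
      refine le_iInf₂ fun P hP => ?_
      rw [hPy P hP.1.1 hP.1.2]
    refine hYh.trans ((Ideal.height_le_spanFinrank Y hY).trans ?_)
    have := Submodule.spanFinrank_span_le_ncard_of_finite (R := R) (Set.finite_range y)
    have h3 : (Set.range y).ncard ≤ t := by
      rw [← Set.image_univ]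
      exact (Set.ncard_image_le).trans (by simp)
    exact_mod_cast this.trans h3
  have : d ≤ t := by exact_mod_cast h2
  omega

theorem eq_maximalIdeal_of_isPrime_of_le {R : Type*} [CommRing R] [IsLocalRing R]
    {I : Ideal R} [IsArtinianRing (R ⧸ I)] (P : Ideal R) (hP : P.IsPrime) (h : I ≤ P) :
    P = IsLocalRing.maximalIdeal R := by
  have : (P.map (Ideal.Quotient.mk I)).IsPrime :=
    Ideal.map_isPrime_of_surjective Ideal.Quotient.mk_surjective (by simpa using h)
  have hmax : (P.map (Ideal.Quotient.mk I)).IsMaximal := inferInstance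
  refine IsLocalRing.eq_maximalIdeal ?_
  have := Ideal.comap_isMaximal_of_surjective (Ideal.Quotient.mk I) Ideal.Quotient.mk_surjective
    (K := P.map (Ideal.Quotient.mk I))
  rwa [Ideal.comap_map_of_surjective _ Ideal.Quotient.mk_surjective, ← RingHom.ker_eq_comap_bot,
    Ideal.mk_ker, sup_eq_left.mpr h] at this

theorem isArtinianRing_quotient_ofList {R : Type*} [CommRing R] [IsLocalRing R]
    [IsNoetherianRing R] {x : List R} (hdim : ringKrullDim R = x.length)
    (hx : RingTheory.Sequence.IsRegular R x) : IsArtinianRing (R ⧸ Ideal.ofList x) := by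
  rw [isArtinianRing_iff_krullDimLE_zero, Ring.krullDimLE_iff]
  have h := ringKrullDim_add_length_eq_ringKrullDim_of_isRegular x hx
  rw [hdim] at h
  generalize ringKrullDim (R ⧸ Ideal.ofList x) = δ at h
  induction δ with
  | bot => simp
  | coe δ =>
    have h' : δ + (x.length : ℕ∞) = 0 + x.length := by
      rw [zero_add]; exact_mod_cast h
    have := WithTop.add_right_cancel (ENat.natCast_ne_top _) h'
    simp [this]

theorem isMinimalReduction_iff_eq {R : Type*} [CommRing R] [IsLocalRing R] [IsNoetherianRing R]
    {x : List R} (hdim : ringKrullDim R = x.length) (hx : RingTheory.Sequence.IsRegular R x)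
    {J : Ideal R} : IsMinimalReduction (Ideal.ofList x) J ↔ J = Ideal.ofList x := by
  have := isArtinianRing_quotient_ofList hdim hx
  have hx1 : Ideal.ofList x ≠ ⊤ := fun h => hx.top_ne_smul (by simp [h])
  have hJ {J : Ideal R} (h : (adicFiltration (Ideal.ofList x)).IsReduction J) :
      J = Ideal.ofList x :=
    eq_of_isReduction hdim x.get (by rw [Set.range_list_get])
      (fun P hP h => eq_maximalIdeal_of_isPrime_of_le P hP h)
      (IsLocalRing.le_maximalIdeal hx1) h
  constructor
  · exact fun h => hJ h.1
  · rintro rfl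
    exact ⟨isReduction_adicFiltration_self _, fun K hK _ => (hJ hK).ge⟩

/-- As `I = (x)` is its only minimal reduction, `r(F)` is the reduction number of `F` with respect
to `I`. -/
theorem IFiltration.mul_eq_of_reductionNumber_le {R : Type*} [CommRing R] [IsLocalRing R]
    [IsNoetherianRing R] {x : List R} (hdim : ringKrullDim R = x.length)
    (hx : RingTheory.Sequence.IsRegular R x) {F : IFiltration (Ideal.ofList x)}
    (hF : F.IsAdmissible) {m : ℤ} (hm : (F.reductionNumber : ℤ) ≤ m) :
    Ideal.ofList x * F.ideal m = F.ideal (m + 1) := by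
  obtain ⟨J, hJ, hr⟩ : F.reductionNumber ∈
      {r : ℕ | ∃ J : Ideal R, IsMinimalReduction (Ideal.ofList x) J ∧
        r = F.reductionNumberWrt J} :=
    Nat.sInf_mem ⟨_, _, (isMinimalReduction_iff_eq hdim hx).mpr rfl, rfl⟩
  rw [(isMinimalReduction_iff_eq hdim hx).mp hJ] at hr
  have h : F.reductionNumberWrt (Ideal.ofList x) ∈
      {n : ℕ | ∀ m : ℤ, (n : ℤ) ≤ m → Ideal.ofList x * F.ideal m = F.ideal (m + 1)} :=
    Nat.sInf_mem (F.eventually_mul_eq hF)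
  rw [← hr] at h
  exact h m hm

/-! ### Binomial identities -/

theorem choose_eq_multichoose {n d i : ℕ} (hi : i ≤ d) :
    (n + d - 1 - i).choose (d - i) = n.multichoose (d - i) := by
  rw [Nat.multichoose_eq]; congr 1; omega

theorem multichoose_succ_eq_multichoose (d n : ℕ) :
    (d + 1).multichoose n = (n + 1).multichoose d := by
  rw [Nat.multichoose_eq, Nat.multichoose_eq, show d + 1 + n - 1 = d + n by omega,
    show n + 1 + d - 1 = d + n by omega, Nat.choose_symm_add]

/-- The coefficient of `t ^ D` in `(1 - t) ^ k * (1 - t) ^ (-m) = (1 - t) ^ (-(m - k))`. -/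
theorem sum_range_choose_mul_multichoose {m k : ℕ} (hk : k ≤ m) (D : ℕ) :
    ∑ l ∈ Finset.range (D + 1), (-1 : ℤ) ^ l * k.choose l * m.multichoose (D - l) =
      (m - k).multichoose D := by
  induction k generalizing D with
  | zero =>
    rw [Finset.sum_range_succ']
    simp
  | succ k ih =>
    cases D with
    | zero => simp
    | succ D =>
      have hm : m - k = m - (k + 1) + 1 := by omega
      have h1 := ih (by omega) (D + 1)
      have h2 := ih (by omega) D
      rw [Finset.sum_range_succ'] at h1 ⊢
      have e : ∀ l ∈ Finset.range (D + 1),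
          (-1 : ℤ) ^ (l + 1) * (k + 1).choose (l + 1) * m.multichoose (D + 1 - (l + 1)) =
          (-1 : ℤ) ^ (l + 1) * k.choose (l + 1) * m.multichoose (D + 1 - (l + 1)) -
            (-1 : ℤ) ^ l * k.choose l * m.multichoose (D - l) := by
        intro l _
        rw [Nat.choose_succ_succ, Nat.add_sub_add_right]
        push_cast
        ring
      rw [Finset.sum_congr rfl e, Finset.sum_sub_distrib, h2]
      rw [hm, Nat.multichoose_succ_succ, ← hm] at h1
      push_cast at h1
      simp only [Nat.choose_zero_right, Nat.add_sub_add_right, Nat.sub_zero] at h1 ⊢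
      linarith

/-- Uniqueness of Hilbert coefficients, by taking differences. -/
theorem eq_zero_of_sum_mul_multichoose_eq_zero (d : ℕ) (b : ℕ → ℤ) (N : ℕ)
    (h : ∀ n, N ≤ n → ∑ i ∈ Finset.range (d + 1), b i * n.multichoose (d - i) = 0) :
    ∀ i ≤ d, b i = 0 := by
  induction d generalizing N with
  | zero => intro i hi; simpa [Nat.le_zero.mp hi] using h N le_rfl
  | succ d ih =>
    have h0 : ∀ i ≤ d, b i = 0 := by
      refine ih (N + 1) fun n hn => ?_
      obtain ⟨n, rfl⟩ : ∃ n', n = n' + 1 := ⟨n - 1, by omega⟩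
      have h1 := h n (by omega)
      have h2 := h (n + 1) (by omega)
      rw [Finset.sum_range_succ] at h1 h2
      have e : ∀ i ∈ Finset.range (d + 1), b i * (n + 1).multichoose (d + 1 - i) =
          b i * n.multichoose (d + 1 - i) + b i * (n + 1).multichoose (d - i) := by
        intro i hi
        have : d + 1 - i = d - i + 1 := by have := Finset.mem_range.mp hi; omega
        rw [this, Nat.multichoose_succ_succ]
        push_cast
        ring
      rw [Finset.sum_congr rfl e, Finset.sum_add_distrib] at h2
      simp only [Nat.sub_self, Nat.multichoose_zero_right] at h1 h2
      linarith
    intro i hi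
    rcases Nat.le_succ_iff.mp hi with hi | rfl
    · exact h0 i hi
    · have h1 := h N le_rfl
      rw [Finset.sum_range_succ, Finset.sum_eq_zero] at h1
      · simpa using h1
      · intro i hi
        rw [h0 i (by have := Finset.mem_range.mp hi; omega), zero_mul]

/-! ### The Hilbert function of a filtration satisfying `HI` -/

namespace IFiltration

section

variable {R : Type*} [CommRing R] {I : Ideal R}

/-- Beyond the reduction number the condition `HI_p` is automatic. -/
theorem SatisfiesHI.of_mul_eq {F : IFiltration I} {N : ℤ}
    (hN : ∀ m : ℤ, N ≤ m → I * F.ideal m = F.ideal (m + 1)) {p : ℤ} (hp : N ≤ p + 1) :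
    F.SatisfiesHI p := by
  have key (j : ℕ) : F.ideal (p + 1) * I ^ j = F.ideal (p + 1 + j) := by
    induction j with
    | zero => simp
    | succ j ih =>
      rw [pow_succ, ← mul_assoc, ih, mul_comm, hN _ (by omega)]
      push_cast
      rw [add_assoc]
  intro n hn
  have h : F.ideal (p + 1) * intPow I (n - p) = F.ideal (n + 1) := by
    rw [intPow, key]
    congr 1
    omega
  rw [h, inf_eq_left, ← h]
  exact Ideal.mul_le_right

theorem ideal_inf_pow_eq {F : IFiltration I} (hHI : ∀ p, F.SatisfiesHI p) {m j : ℕ} (hj : j < m) :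
    F.ideal m ⊓ I ^ j = F.ideal ((m - 1 - j : ℕ) + 1) * I ^ j := by
  have h := hHI ((m - 1 - j : ℕ) : ℤ) (m - 1) (by omega)
  have e : (m : ℤ) - 1 - (m - 1 - j : ℕ) = j := by omega
  rw [sub_add_cancel, e] at h
  exact h

theorem ideal_succ_inf_eq {F : IFiltration I} (hHI : ∀ p, F.SatisfiesHI p) (k : ℕ) :
    F.ideal (k + 1) ⊓ I = I * F.ideal k := by
  have h := hHI (k - 1) k (by omega)
  have e : (k : ℤ) - (k - 1) = 1 := by ring
  rw [sub_add_cancel, e, mul_comm] at h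
  simpa [intPow] using h

theorem stepLength_eq_subquotientLength_sup {F : IFiltration I} (hHI : ∀ p, F.SatisfiesHI p)
    (k : ℕ) : F.stepLength k = subquotientLength (F.ideal (k + 1) ⊔ I) I := by
  rw [← subquotientLength_inf_left, ideal_succ_inf_eq hHI]
  rfl

theorem stepLength_ne_top {F : IFiltration I} (hHI : ∀ p, F.SatisfiesHI p)
    (hfin : Module.length R (R ⧸ I) ≠ ⊤) (k : ℕ) : F.stepLength k ≠ ⊤ := by
  rw [stepLength_eq_subquotientLength_sup hHI]
  exact subquotientLength_ne_top le_sup_right hfin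

theorem stepLength_eq_zero {F : IFiltration I} {k : ℕ} (h : I * F.ideal k = F.ideal (k + 1)) :
    F.stepLength k = 0 := by
  rw [stepLength, h, Submodule.submoduleOf_self, Module.length_eq_zero_iff]
  exact Submodule.Quotient.subsingleton_iff.mpr rfl

end

section

open RingTheory.Sequence

variable {R : Type*} [CommRing R] {x : List R} {F : IFiltration (Ideal.ofList x)}

/-- The factors `(I_m ∩ I ^ j) / (I_m ∩ I ^ (j + 1))` of the chain from `I_m` down to `I_m ∩ I ^ t`
are, by `HI`, isomorphic to `A I ^ j / I ^ (j + 1)` with `A = I_{m-j} + I`. -/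
theorem length_quotient_inf_pow (hx : IsWeaklyRegular R x)
    (hfin : Module.length R (R ⧸ Ideal.ofList x) ≠ ⊤) (hHI : ∀ p, F.SatisfiesHI p) {m t : ℕ}
    (ht : t ≤ m) :
    Module.length R (R ⧸ F.ideal m ⊓ Ideal.ofList x ^ t) =
      ∑ j ∈ Finset.range t, x.length.multichoose j * F.stepLength (m - 1 - j) +
        F.hilbertFunction m := by
  induction t with
  | zero =>
    rw [pow_zero, Ideal.one_eq_top, inf_top_eq, Finset.range_zero, Finset.sum_empty, zero_add]
    rfl
  | succ t ih =>
    have hle : Ideal.ofList x ^ (t + 1) ≤ Ideal.ofList x ^ t := Ideal.pow_le_pow_right t.le_succ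
    have h1 : F.ideal m ⊓ Ideal.ofList x ^ (t + 1) =
        F.ideal m ⊓ Ideal.ofList x ^ t ⊓ Ideal.ofList x ^ (t + 1) := by
      rw [inf_assoc, inf_eq_right.mpr hle]
    have h2 : F.ideal m ⊓ Ideal.ofList x ^ t ⊔ Ideal.ofList x ^ (t + 1) =
        (F.ideal ((m - 1 - t : ℕ) + 1) ⊔ Ideal.ofList x) * Ideal.ofList x ^ t := by
      rw [ideal_inf_pow_eq hHI (by omega), Ideal.sup_mul, pow_succ']
    rw [length_quotient_eq_add (inf_le_inf_left _ hle), h1, subquotientLength_inf_left, h2,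
      subquotientLength_mul_pow hx hfin le_sup_right, ih (by omega), Finset.sum_range_succ,
      stepLength_eq_subquotientLength_sup hHI]
    ring

/-- The Hilbert functions of `F` and of the `I`-adic filtration compared: the chain of
`length_quotient_inf_pow` ends at `I_{n+1} ∩ I ^ (n + 1) = I ^ (n + 1)`. -/
theorem hilbertFunction_add_sum (hx : IsWeaklyRegular R x)
    (hfin : Module.length R (R ⧸ Ideal.ofList x) ≠ ⊤) (hHI : ∀ p, F.SatisfiesHI p) (n : ℕ) :
    ∑ k ∈ Finset.range (n + 1), x.length.multichoose (n - k) * F.stepLength k +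
        F.hilbertFunction (n + 1 : ℕ) =
      (n + 1).multichoose x.length * Module.length R (R ⧸ Ideal.ofList x) := by
  have h := length_quotient_inf_pow hx hfin hHI (le_refl (n + 1))
  have h' := (isWeaklyRegular_and_length_quotient_pow x [] (by simpa using hx) n).2
  have e : F.ideal (n + 1 : ℕ) ⊓ Ideal.ofList x ^ (n + 1) = Ideal.ofList x ^ (n + 1) := by
    have := F.pow_le (n + 1 : ℕ)
    rw [intPow, Int.toNat_natCast] at this
    exact inf_eq_right.mpr this
  rw [Ideal.ofList_nil, sup_bot_eq, sup_bot_eq, multichoose_succ_eq_multichoose] at h'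
  rw [e, h', ← Finset.sum_range_reflect] at h
  rw [h]
  congr 1
  refine Finset.sum_congr rfl fun k hk => ?_
  have := Finset.mem_range.mp hk
  congr 2
  omega

/-- The expected Hilbert coefficients: `ℓ(R / I)` at index `0`, and
`∑ k, C(k, i) ℓ(I_{k+1} / I I_k)` at index `i + 1`. The sum is cut off at `k < N`, where `N` is to be
at least the reduction number. -/
noncomputable def coeffFormula (F : IFiltration (Ideal.ofList x)) (N : ℕ) : ℕ → ℤ
  | 0 => (Module.length R (R ⧸ Ideal.ofList x)).toNat
  | i + 1 => ∑ k ∈ Finset.range N, (k.choose i : ℤ) * (F.stepLength k).toNat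

theorem hilbertFunction_eq_sum_coeffFormula (hx : IsWeaklyRegular R x)
    (hfin : Module.length R (R ⧸ Ideal.ofList x) ≠ ⊤) (hHI : ∀ p, F.SatisfiesHI p) {N : ℕ}
    (hN : ∀ k, N ≤ k → F.stepLength k = 0) {n : ℕ} (hn : N < n) :
    F.hilbertFunction n ≠ ⊤ ∧ ((F.hilbertFunction n).toNat : ℤ) =
      ∑ i ∈ Finset.range (x.length + 1),
        (-1) ^ i * F.coeffFormula N i * n.multichoose (x.length - i) := by
  obtain ⟨n, rfl⟩ : ∃ n', n = n' + 1 := ⟨n - 1, by omega⟩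
  have h := hilbertFunction_add_sum hx hfin hHI n
  set L := Module.length R (R ⧸ Ideal.ofList x) with hL
  have hstep (k : ℕ) : F.stepLength k = ((F.stepLength k).toNat : ℕ∞) :=
    (ENat.natCast_toNat (stepLength_ne_top hHI hfin k)).symm
  have hLc : L = (L.toNat : ℕ∞) := (ENat.natCast_toNat hfin).symm
  have hne : F.hilbertFunction (n + 1 : ℕ) ≠ ⊤ := by
    refine ne_top_of_le_ne_top ?_ (le_add_self.trans h.le)
    rw [hLc]
    exact_mod_cast ENat.natCast_ne_top _
  refine ⟨hne, ?_⟩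
  have hHc := (ENat.natCast_toNat hne).symm
  have hZ : ∑ k ∈ Finset.range N, (x.length.multichoose (n - k) : ℤ) * (F.stepLength k).toNat +
      (F.hilbertFunction (n + 1 : ℕ)).toNat = (n + 1).multichoose x.length * L.toNat := by
    have e : ∑ k ∈ Finset.range N, (x.length.multichoose (n - k) : ℤ) * (F.stepLength k).toNat =
        ∑ k ∈ Finset.range (n + 1), (x.length.multichoose (n - k) : ℤ) *
          (F.stepLength k).toNat := by
      refine Finset.sum_subset (Finset.range_mono (by omega)) fun k _ hk => ?_
      rw [hN k (by simpa using hk)]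
      simp
    rw [e]
    rw [hHc, hLc, Finset.sum_congr rfl fun k _ => by rw [hstep k]] at h
    exact_mod_cast h
  rw [Finset.sum_range_succ']
  have hsum : ∑ i ∈ Finset.range x.length, (-1 : ℤ) ^ (i + 1) * F.coeffFormula N (i + 1) *
        (n + 1).multichoose (x.length - (i + 1)) =
      -∑ k ∈ Finset.range N, (x.length.multichoose (n - k) : ℤ) * (F.stepLength k).toNat := by
    simp only [coeffFormula, Finset.mul_sum, Finset.sum_mul]
    rw [Finset.sum_comm, ← Finset.sum_neg_distrib]
    refine Finset.sum_congr rfl fun k hk => ?_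
    have hk' := Finset.mem_range.mp hk
    rcases hd : x.length with _ | D
    -- for `d = 0` both sides vanish, as `n - k` is positive
    · obtain ⟨c, hc⟩ : ∃ c, n - k = c + 1 := ⟨n - k - 1, by omega⟩
      simp [hc]
    · have hkm : n + 1 - k = n - k + 1 := by omega
      rw [multichoose_succ_eq_multichoose, ← hkm,
        ← sum_range_choose_mul_multichoose (by omega : k ≤ n + 1), Finset.sum_mul,
        ← Finset.sum_neg_distrib]
      refine Finset.sum_congr rfl fun l _ => ?_
      rw [Nat.add_sub_add_right]
      ring
  rw [hsum]
  simp only [coeffFormula, pow_zero, Nat.sub_zero, one_mul]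
  rw [← hL]
  linarith

theorem hasHilbertCoefficients_iff (hx : IsWeaklyRegular R x)
    (hfin : Module.length R (R ⧸ Ideal.ofList x) ≠ ⊤) (hHI : ∀ p, F.SatisfiesHI p) {N : ℕ}
    (hN : ∀ k, N ≤ k → F.stepLength k = 0) {e : Fin (x.length + 1) → ℤ} :
    F.HasHilbertCoefficients x.length e ↔ ∀ i : Fin (x.length + 1), e i = F.coeffFormula N i := by
  have hform (c : ℕ → ℤ) (n : ℕ) : ∑ i : Fin (x.length + 1), (-1) ^ (i : ℕ) * c i *
        ((n + x.length - 1 - i).choose (x.length - i) : ℤ) =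
      ∑ i ∈ Finset.range (x.length + 1), (-1) ^ i * c i * n.multichoose (x.length - i) := by
    rw [Finset.sum_range]
    refine Finset.sum_congr rfl fun i _ => ?_
    rw [choose_eq_multichoose (Nat.lt_succ_iff.mp i.2)]
  -- extend `e` to all natural numbers, to sum over `Finset.range`
  obtain ⟨c, rfl⟩ : ∃ c : ℕ → ℤ, e = fun i : Fin (x.length + 1) => c i :=
    ⟨fun i => if h : i < x.length + 1 then e ⟨i, h⟩ else 0, by
      ext i; beta_reduce; rw [dif_pos i.2]⟩
  constructor
  · rintro ⟨M, hM⟩ i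
    have h0 := eq_zero_of_sum_mul_multichoose_eq_zero x.length
      (fun i => (-1) ^ i * (c i - F.coeffFormula N i)) (max M N + 1) (fun n hn => ?_) i
      (Nat.lt_succ_iff.mp i.2)
    · have := (mul_eq_zero.mp h0).resolve_left (pow_ne_zero _ (by norm_num))
      exact sub_eq_zero.mp this
    · have h1 := (hM n (by omega) (by omega)).2
      rw [hform, (hilbertFunction_eq_sum_coeffFormula hx hfin hHI hN (by omega)).2] at h1
      simp only [mul_sub, sub_mul, Finset.sum_sub_distrib]
      rw [h1, sub_self]
  · intro h
    refine ⟨N + 1, fun n hn _ => ?_⟩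
    rw [hform]
    obtain ⟨h1, h2⟩ := hilbertFunction_eq_sum_coeffFormula hx hfin hHI hN (show N < n by omega)
    refine ⟨h1, h2.trans (Finset.sum_congr rfl fun i hi => ?_)⟩
    rw [← h ⟨i, Finset.mem_range.mp hi⟩]

theorem hasSum_coeffFormula {N : ℕ} (hN : ∀ k, N ≤ k → F.stepLength k = 0) (i : ℕ) :
    HasSum (fun k : {k : ℕ // i ≤ k} => ((k : ℕ).choose i : ℤ) * ((F.stepLength k).toNat : ℤ))
      (F.coeffFormula N (i + 1)) := by
  have hsupp : Function.support (fun k : ℕ => (k.choose i : ℤ) * ((F.stepLength k).toNat : ℤ)) ⊆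
      {k | i ≤ k} := by
    intro k hk
    by_contra hki
    exact hk (by simp [Nat.choose_eq_zero_of_lt (not_le.mp hki)])
  refine (hasSum_subtype_iff_of_support_subset hsupp).mpr (hasSum_sum_of_ne_finset_zero ?_)
  intro k hk
  rw [hN k (by simpa using hk)]
  simp

end

end IFiltration

end HilbertCoeff

theorem mainTheorem2 {R : Type*} [CommRing R] [IsLocalRing R] [IsNoetherianRing R]
    (d : ℕ) (hdim : ringKrullDim R = d) (hCM : HilbertCoeff.IsCohenMacaulayLocal R)
    (I : Ideal R) (x : List R) (hxlen : x.length = d)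
    (hreg : RingTheory.Sequence.IsRegular R x) (hI : I = Ideal.ofList x)
    (F : HilbertCoeff.IFiltration I) (hF : F.IsAdmissible)
    (hHI : ∀ p : ℤ, p ≤ (F.reductionNumber : ℤ) - 2 → F.SatisfiesHI p) :
    (∃ e : Fin (d + 1) → ℤ, F.HasHilbertCoefficients d e) ∧
    (∀ k : ℕ, F.stepLength k ≠ ⊤) ∧
    ∀ e : Fin (d + 1) → ℤ, F.HasHilbertCoefficients d e →
      ∀ i : Fin (d + 1), 1 ≤ (i : ℕ) →
        HasSum
          (fun k : {k : ℕ // (i : ℕ) - 1 ≤ k} =>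
            ((k : ℕ).choose ((i : ℕ) - 1) : ℤ) * ((F.stepLength k).toNat : ℤ))
          (e i) := by
  subst hI
  subst hxlen
  have := HilbertCoeff.isArtinianRing_quotient_ofList hdim hreg
  have hfin : Module.length R (R ⧸ Ideal.ofList x) ≠ ⊤ := by
    rw [Module.length_eq_of_surjective (R := R ⧸ Ideal.ofList x) (S := R)
      (M := R ⧸ Ideal.ofList x) Ideal.Quotient.mk_surjective]
    exact Module.length_ne_top
  have hr : ∀ m : ℤ, (F.reductionNumber : ℤ) ≤ m → Ideal.ofList x * F.ideal m = F.ideal (m + 1) :=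
    fun m hm => F.mul_eq_of_reductionNumber_le hdim hreg hF hm
  have hHI' : ∀ p, F.SatisfiesHI p := fun p => by
    by_cases hp : p ≤ (F.reductionNumber : ℤ) - 2
    · exact hHI p hp
    · exact .of_mul_eq hr (by omega)
  have hN : ∀ k, F.reductionNumber ≤ k → F.stepLength k = 0 := fun k hk =>
    HilbertCoeff.IFiltration.stepLength_eq_zero (hr k (by exact_mod_cast hk))
  have hiff {e : Fin (x.length + 1) → ℤ} :=
    HilbertCoeff.IFiltration.hasHilbertCoefficients_iff (e := e) hreg.toIsWeaklyRegular hfin hHI' hN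
  refine ⟨⟨_, hiff.mpr fun _ => rfl⟩,
    HilbertCoeff.IFiltration.stepLength_ne_top hHI' hfin, fun e he i hi => ?_⟩
  rw [hiff.mp he i]
  have h := HilbertCoeff.IFiltration.hasSum_coeffFormula (F := F) hN ((i : ℕ) - 1)
  rwa [Nat.sub_add_cancel hi] at h
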